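/- Let $k$ be a field, $V=\mathbb{A}^n_k$ with coordinates $x_1,\dots,x_n$, and $f\in k[x_1,\dots,x_n]$ homogeneous of degree $d\ge 0$. The polar map of $f$ is the morphism $\phi_f\colon V\to V^*$, $x\mapsto df|_x=(\partial_1 f(x),\dots,\partial_n f(x))$. For a morphism $\phi\colon X\to Y$ of affine spaces over $k$, its Thom–Boardman rank $\mathrm{rk}^{TB}(\phi)$ is the codimension in the tangent bundle $TX$ of the closed subvariety $Z_\phi=\{(x,v)\in TX : d\phi_x(v)=0\}$. Let $c(f)$ be the codimension in $V$ of the singular locus $\{f=0,\ df=0\}$ of the hypersurface $f=0$. (Codimensions are those of closed subsets of affine space as a scheme over $k$; the empty set has codimension $\infty$.) The projective hypersurface $f=0$ is smooth if there is no nonzero $a\in\bar k^{\,n}$ with $f(a)=0$ and $\partial_i f(a)=0$ for all $i$. Assume that $\mathrm{char}(k)$ does not divide $d-1$ (characteristic $0$ divides only $0$). Then: 1. $\mathrm{rk}^{TB}(\phi_f)\ \ge\ \mathrm{codim}_V\{df=0\}$. 2. In particular, if there is no nonzero $a\in\bar k^{\,n}$ with $\partial_i f(a)=0$ for all $i$,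 then $\mathrm{rk}^{TB}(\phi_f)=n=\dim V$. 3. If moreover $\mathrm{char}(k)$ does not divide $d$, then $\mathrm{rk}^{TB}(\phi_f)\ge c(f)$; in particular, $\mathrm{rk}^{TB}(\phi_f)=\dim V$ whenever the projective hypersurface $f=0$ is smooth. -/

import Mathlib

namespace PolarRank

open MvPolynomial

/-- Codimension of a closed subset `Z` of an affine scheme `Spec R`: the infimum over the points of
`Z` of the heights of the corresponding primes (so that the empty set has codimension `⊤`). -/
noncomputable def codim {R : Type*} [CommRing R] (Z : Set (PrimeSpectrum R)) : ℕ∞ :=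
  ⨅ x ∈ Z, x.asIdeal.height

/-- For the morphism `φ : 𝔸^σ → 𝔸^τ` of affine spaces over `k` with components `φ j`, the `j`-th
component `∑ i, (∂ φ_j / ∂ x_i)(x) v_i` of `dφ_x(v)`, as a polynomial on the tangent bundle
`T 𝔸^σ = 𝔸^σ × 𝔸^σ`. The variables `Sum.inl i` are the coordinates of the base point `x`, the
variables `Sum.inr i` are the coordinates of the tangent vector `v`. -/
noncomputable def differential {k σ τ : Type*} [Field k] [Fintype σ]
    (φ : τ → MvPolynomial σ k) (j : τ) : MvPolynomial (σ ⊕ σ) k :=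
  ∑ i, rename Sum.inl (pderiv i (φ j)) * X (Sum.inr i)

/-- The subvariety `Z_φ = {(x, v) | dφ_x(v) = 0}` of the tangent bundle of `𝔸^σ`. -/
noncomputable def tangentKernel {k σ τ : Type*} [Field k] [Fintype σ]
    (φ : τ → MvPolynomial σ k) : Set (PrimeSpectrum (MvPolynomial (σ ⊕ σ) k)) :=
  PrimeSpectrum.zeroLocus (Set.range (differential φ))

/-- The Thom-Boardman rank of a morphism of affine spaces: the codimension of `Z_φ` in the
tangent bundle of the source. -/
noncomputable def rkTB {k σ τ : Type*} [Field k] [Fintype σ]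
    (φ : τ → MvPolynomial σ k) : ℕ∞ :=
  codim (tangentKernel φ)

/-- The polar map `x ↦ df|_x` from `V = 𝔸^σ` to its dual, in coordinates. -/
noncomputable def polarMap {k σ : Type*} [Field k] (f : MvPolynomial σ k) :
    σ → MvPolynomial σ k :=
  fun i => pderiv i f

/-- The critical locus `df = 0` in `V = 𝔸^σ`. -/
noncomputable def criticalLocus {k σ : Type*} [Field k] (f : MvPolynomial σ k) :
    Set (PrimeSpectrum (MvPolynomial σ k)) :=
  PrimeSpectrum.zeroLocus (Set.range fun i => pderiv i f)

/-- The singular (that is, non-smooth) locus `f = 0, df = 0` of the hypersurface `f = 0` in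
`V = 𝔸^σ`. -/
noncomputable def singularLocus {k σ : Type*} [Field k] (f : MvPolynomial σ k) :
    Set (PrimeSpectrum (MvPolynomial σ k)) :=
  PrimeSpectrum.zeroLocus {f} ∩ criticalLocus f

/-- The invariant `c(f)`: the codimension in `V` of the singular locus of `f = 0`. -/
noncomputable def c {k σ : Type*} [Field k] (f : MvPolynomial σ k) : ℕ∞ :=
  codim (singularLocus f)

/-- The projective hypersurface `f = 0` of a homogeneous polynomial `f` is smooth over `k`: at
every geometric point of it, given by homogeneous coordinates `a`, some partial derivative of `f`
does not vanish. -/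
def SmoothProjectiveHypersurface {k σ : Type*} [Field k] (f : MvPolynomial σ k) : Prop :=
  ∀ a : σ → AlgebraicClosure k, a ≠ 0 → aeval a f = 0 → ∃ i, aeval a (pderiv i f) ≠ 0

end PolarRank

namespace PolarRank

open MvPolynomial

/-! Intersect `Z_φ` with the diagonal `v = x` of `TV`. Euler's identity for the `∂ᵢf`, of degree `d
- 1`, turns its equations into `(d - 1) ∂ᵢf = 0`, so the intersection is `df = 0`. The diagonal is
cut out by `n` linear forms, so at the origin the dimension drops by at most `n`. Every component
can be tested at the origin, because the equations are homogeneous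
(`exists_prime_le_ker_constantCoeff`). Turning dimensions back into codimensions uses
`card_le_height_quotient_add_height`. Equality with `n` holds because the zero section lies in
`Z_φ`, while a critical locus reduced to the origin has codimension `n`. If `d ≠ 0` in `k`, Euler's
identity for `f` shows that `df = 0` forces `f = 0`. -/

/-! ### Heights under surjections and integral extensions. -/

/-- A chain below `P` pulls back to primes containing the nonzero kernel, so `⊥` can be added
underneath. -/
theorem height_add_one_le_height_comap {R S : Type*} [CommRing R] [IsDomain R] [CommRing S]
    [IsNoetherianRing S]
    (φ : R →+* S) (hφ : Function.Surjective φ) (hker : RingHom.ker φ ≠ ⊥) (P : Ideal S) [P.IsPrime] :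
    P.height + 1 ≤ (P.comap φ).height := by
  obtain ⟨l, hl, hlen⟩ := P.exists_ltSeries_length_eq_height
  let l' : LTSeries (PrimeSpectrum R) :=
    l.map (PrimeSpectrum.comap φ) (RingHom.strictMono_comap_of_surjective hφ)
  have hlt : (⟨⊥, Ideal.isPrime_bot⟩ : PrimeSpectrum R) < l'.head := by
    rw [← PrimeSpectrum.asIdeal_lt_asIdeal]
    refine lt_of_lt_of_le (bot_lt_iff_ne_bot.mpr hker) ?_
    simp only [l', LTSeries.head_map, PrimeSpectrum.comap_asIdeal]
    exact Ideal.ker_le_comap φ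
  have h := Order.length_le_height (p := l'.cons _ hlt)
    (x := PrimeSpectrum.comap φ ⟨P, inferInstance⟩) (by simp [l', hl])
  rw [← hlen]
  have h2 := PrimeSpectrum.height_eq_orderHeight (PrimeSpectrum.comap φ ⟨P, inferInstance⟩)
  rw [PrimeSpectrum.comap_asIdeal] at h2
  rw [h2]
  simpa [l'] using h

/-- This is going-down for integral extensions of a normal domain. -/
theorem height_comap_le_of_isIntegral {R S : Type*} [CommRing R] [CommRing S] [IsDomain S]
    [IsNoetherianRing R] [IsNoetherianRing S] [IsDomain R] [IsIntegrallyClosed R]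
    (g : R →+* S) (hg : Function.Injective g) (hi : g.IsIntegral) (P : Ideal S) [P.IsPrime] :
    (P.comap g).height ≤ P.height := by
  algebraize [g]
  have : FaithfulSMul R S := (faithfulSMul_iff_algebraMap_injective R S).mpr hg
  have : P.LiesOver (P.comap g) := ⟨rfl⟩
  rw [Ideal.height_eq_height_add_of_liesOver_of_hasGoingDown (P.comap g) P]
  exact le_self_add

theorem ringKrullDim_le_of_isIntegral {R S : Type*} [CommRing R] [CommRing S]
    (g : R →+* S) (hi : g.IsIntegral) : ringKrullDim S ≤ ringKrullDim R := by
  algebraize [g]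
  refine Order.krullDim_le_of_strictMono (PrimeSpectrum.comap g) fun p q hpq => ?_
  rw [← PrimeSpectrum.asIdeal_lt_asIdeal] at hpq ⊢
  exact Ideal.IsIntegral.comap_lt_comap hpq

theorem exists_prime_height_add_le {R S : Type*} [CommRing R] [CommRing S] (φ : R →+* S)
    (hφ : Function.Surjective φ) {n t : ℕ} (hn : ringKrullDim R ≤ n) (ht : t ≤ ringKrullDim S) :
    ∃ Q : PrimeSpectrum R, RingHom.ker φ ≤ Q.asIdeal ∧ Q.asIdeal.height + t ≤ n := by
  obtain ⟨l, hl⟩ := Order.le_krullDim_iff.mp ht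
  let l' : LTSeries (PrimeSpectrum R) :=
    l.map (PrimeSpectrum.comap φ) (RingHom.strictMono_comap_of_surjective hφ)
  refine ⟨l'.head, ?_, ?_⟩
  · simp only [l', LTSeries.head_map, PrimeSpectrum.comap_asIdeal]
    exact Ideal.ker_le_comap φ
  · rw [PrimeSpectrum.height_eq_orderHeight]
    have h1 : (t : ℕ∞) ≤ Order.coheight l'.head := by
      rw [← hl]
      exact Order.length_le_coheight_head (p := l')
    have : Nonempty (PrimeSpectrum R) := ⟨l'.head⟩
    have h2 : ((Order.height l'.head + Order.coheight l'.head : ℕ∞) : WithBot ℕ∞) ≤ n := by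
      refine le_trans ?_ hn
      rw [ringKrullDim, Order.krullDim_eq_iSup_height_add_coheight_of_nonempty]
      exact WithBot.coe_le_coe.mpr (le_iSup (fun a : PrimeSpectrum R =>
        Order.height a + Order.coheight a) l'.head)
    exact (add_le_add_right h1 _).trans (by exact_mod_cast h2)

/-! ### The dimension formula in polynomial rings. -/

theorem height_of_isMaximal_fin {k : Type*} [Field k] (n : ℕ)
    (M : Ideal (MvPolynomial (Fin n) k)) [M.IsMaximal] : M.height = n := by
  induction n with
  | zero =>
    refine le_antisymm ?_ (by simp)
    have := Ideal.height_le_ringKrullDim_of_ne_top (Ideal.IsPrime.ne_top' (I := M))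
    simpa using this
  | succ n ih =>
    let e := (finSuccEquiv k n).toRingEquiv
    have : (M.comap e.symm).IsMaximal := Ideal.comap_isMaximal_of_equiv e.symm
    have hm : ((M.comap e.symm).comap Polynomial.C).IsMaximal :=
      Polynomial.isMaximal_comap_C_of_isJacobsonRing _
    have : (M.comap e.symm).LiesOver ((M.comap e.symm).comap Polynomial.C) := ⟨rfl⟩
    rw [← RingEquiv.height_comap e.symm M,
      Polynomial.height_eq_height_add_one ((M.comap e.symm).comap Polynomial.C), ih]
    simp

theorem height_of_isMaximal {k ι : Type*} [Field k] [Fintype ι]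
    (M : Ideal (MvPolynomial ι k)) [M.IsMaximal] : M.height = Fintype.card ι := by
  let e := (renameEquiv k (Fintype.equivFin ι)).toRingEquiv
  have : (M.comap e.symm).IsMaximal := Ideal.comap_isMaximal_of_equiv e.symm
  rw [← RingEquiv.height_comap e.symm M, height_of_isMaximal_fin]

/-- Induction on `n`: divide by a prime element of `P`, normalize the resulting hypersurface over `n
- 1` variables, and apply the induction hypothesis to the contraction of `P` there. Going-down
controls the height of that contraction. -/
theorem exists_noether_normalization_le_height {k : Type*} [Field k] (n : ℕ)
    (P : Ideal (MvPolynomial (Fin n) k)) [hP : P.IsPrime] :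
    ∃ s, ∃ g : MvPolynomial (Fin s) k →ₐ[k] MvPolynomial (Fin n) k ⧸ P,
      Function.Injective g ∧ g.IsIntegral ∧ (n : ℕ∞) ≤ s + P.height := by
  induction n using Nat.strong_induction_on with
  | _ n ih =>
    by_cases hbot : P = ⊥
    · have hb : Function.Bijective (Ideal.Quotient.mkₐ k P) :=
        (Ideal.Quotient.mk_bijective_iff_eq_bot P).mpr hbot
      exact ⟨n, Ideal.Quotient.mkₐ k P, hb.1, RingHom.isIntegral_of_surjective _ hb.2,
        le_self_add⟩
    obtain ⟨f, hfP, hf⟩ := hP.exists_mem_prime_of_ne_bot hbot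
    set J : Ideal (MvPolynomial (Fin n) k) := Ideal.span {f}
    have hJ : J.IsPrime := (Ideal.span_singleton_prime hf.ne_zero).mpr hf
    have hJP : J ≤ P := (Ideal.span_singleton_le_iff_mem P).mpr hfP
    have hJbot : J ≠ ⊥ := by simpa [J] using hf.ne_zero
    obtain ⟨s, -, g, hg, hgi⟩ := exists_integral_inj_algHom_of_quotient J hJ.ne_top
    let P' := P.map (Ideal.Quotient.mk J)
    have hP' : P'.IsPrime := Ideal.isPrime_map_quotientMk_of_isPrime hJP
    have hcomap : P'.comap (Ideal.Quotient.mk J) = P := by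
      rw [Ideal.comap_map_of_surjective' _ Ideal.Quotient.mk_surjective, Ideal.mk_ker,
        sup_eq_left.mpr hJP]
    obtain ⟨M, hM, hPM⟩ := Ideal.exists_le_maximal P hP.ne_top
    have hdim : ringKrullDim (MvPolynomial (Fin n) k) = n := by simp
    -- the quotient by `f` has dimension exactly `n - 1`
    have hns : n ≤ s + 1 := by
      have h1 := Ideal.height_le_ringKrullDim_quotient_add_one (hPM hfP)
      rw [height_of_isMaximal_fin] at h1
      have h2 : ringKrullDim (MvPolynomial (Fin n) k ⧸ J) ≤ s := by
        simpa using ringKrullDim_le_of_isIntegral g.toRingHom hgi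
      have h3 : ((n : ℕ) : WithBot ℕ∞) ≤ s + 1 := h1.trans (by gcongr)
      exact_mod_cast h3
    have hsn : s < n := by
      obtain ⟨N, hN, hPN⟩ := Ideal.exists_le_maximal P' hP'.ne_top
      have : (N.comap g.toRingHom).IsMaximal := by
        algebraize [g.toRingHom]
        exact Ideal.isMaximal_comap_of_isIntegral_of_isMaximal N
      have h1 := height_comap_le_of_isIntegral g.toRingHom hg hgi N
      rw [height_of_isMaximal_fin] at h1
      have h2 := height_add_one_le_height_comap (Ideal.Quotient.mk J) Ideal.Quotient.mk_surjective
        (by rwa [Ideal.mk_ker]) N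
      have : (N.comap (Ideal.Quotient.mk J)).IsMaximal :=
        Ideal.comap_isMaximal_of_surjective _ Ideal.Quotient.mk_surjective
      rw [height_of_isMaximal_fin] at h2
      have h3 : (s : ℕ∞) + 1 ≤ n := (by gcongr : (s : ℕ∞) + 1 ≤ N.height + 1).trans h2
      exact_mod_cast h3
    obtain ⟨t, h, hh, hhi, hht⟩ := ih s hsn (P'.comap g.toRingHom)
    let q : MvPolynomial (Fin n) k ⧸ J →ₐ[k] MvPolynomial (Fin n) k ⧸ P :=
      Ideal.Quotient.factorₐ k hJP
    have hq : RingHom.ker q = P' := Ideal.Quotient.factor_ker hJP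
    have hqs : Function.Surjective q := Ideal.Quotient.factor_surjective hJP
    -- The normalization of the hypersurface descends to an integral injection into the quotient by
    -- `P`.
    let r : MvPolynomial (Fin s) k ⧸ P'.comap g.toRingHom →ₐ[k] MvPolynomial (Fin n) k ⧸ P :=
      Ideal.Quotient.liftₐ _ (q.comp g) fun a ha => by
        rw [Ideal.mem_comap, ← hq] at ha
        exact ha
    have hr : Function.Injective r := by
      rw [injective_iff_map_eq_zero]
      intro a ha
      obtain ⟨a, rfl⟩ := Ideal.Quotient.mk_surjective a
      rw [Ideal.Quotient.eq_zero_iff_mem, Ideal.mem_comap, ← hq]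
      exact ha
    have hri : r.IsIntegral := by
      have h1 : (q.comp g).IsIntegral :=
        RingHom.IsIntegral.trans _ _ hgi (RingHom.isIntegral_of_surjective _ hqs)
      have h2 : (r.comp (Ideal.Quotient.mkₐ k _)) = q.comp g := by
        ext; rfl
      rw [← h2] at h1
      exact RingHom.IsIntegral.tower_top _ _ h1
    refine ⟨t, r.comp h, hr.comp hh, RingHom.IsIntegral.trans _ _ hhi hri, ?_⟩
    have h1 := height_comap_le_of_isIntegral g.toRingHom hg hgi P'
    have h2 := height_add_one_le_height_comap (Ideal.Quotient.mk J) Ideal.Quotient.mk_surjective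
      (by rwa [Ideal.mk_ker]) P'
    rw [hcomap] at h2
    calc (n : ℕ∞) ≤ s + 1 := by exact_mod_cast hns
      _ ≤ t + (P'.comap g.toRingHom).height + 1 := by gcongr
      _ ≤ t + (P'.height + 1) := by rw [add_assoc]; gcongr
      _ ≤ t + P.height := by gcongr

theorem card_le_height_quotient_add_height_fin {k : Type*} [Field k] {n : ℕ}
    (P M : Ideal (MvPolynomial (Fin n) k)) [P.IsPrime] [M.IsMaximal] (hPM : P ≤ M) :
    (n : ℕ∞) ≤ (M.map (Ideal.Quotient.mk P)).height + P.height := by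
  obtain ⟨s, g, hg, hgi, hs⟩ := exists_noether_normalization_le_height n P
  have hM : (M.map (Ideal.Quotient.mk P)).IsMaximal :=
    .map_of_surjective_of_ker_le Ideal.Quotient.mk_surjective (by rwa [Ideal.mk_ker])
  refine hs.trans ?_
  gcongr
  have : ((M.map (Ideal.Quotient.mk P)).comap g.toRingHom).IsMaximal := by
    algebraize [g.toRingHom]
    exact Ideal.isMaximal_comap_of_isIntegral_of_isMaximal _
  have h1 := height_comap_le_of_isIntegral g.toRingHom hg hgi (M.map (Ideal.Quotient.mk P))
  rwa [height_of_isMaximal_fin] at h1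

/-- In a polynomial ring over a field, `ht(M / P) + ht(P)` is at least (in fact equal to) the number
of variables, for every prime ideal `P` contained in a maximal ideal `M`. -/
theorem card_le_height_quotient_add_height {k ι : Type*} [Field k] [Fintype ι]
    (P M : Ideal (MvPolynomial ι k)) [P.IsPrime] [M.IsMaximal] (hPM : P ≤ M) :
    (Fintype.card ι : ℕ∞) ≤ (M.map (Ideal.Quotient.mk P)).height + P.height := by
  let e := (renameEquiv k (Fintype.equivFin ι)).toRingEquiv
  have : (M.comap e.symm).IsMaximal := Ideal.comap_isMaximal_of_equiv e.symm
  have h := card_le_height_quotient_add_height_fin (P.comap e.symm) (M.comap e.symm)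
    (Ideal.comap_mono hPM)
  let E : MvPolynomial ι k ⧸ P ≃+* MvPolynomial (Fin (Fintype.card ι)) k ⧸ P.comap e.symm :=
    Ideal.quotientEquiv P (P.comap e.symm) e (Ideal.map_comap_of_equiv e).symm
  have hE : (M.map (Ideal.Quotient.mk P)).map E =
      (M.comap e.symm).map (Ideal.Quotient.mk (P.comap e.symm)) := by
    have hM : M.comap e.symm = M.map e := (Ideal.map_comap_of_equiv e).symm
    rw [hM, ← Ideal.map_coe E, ← Ideal.map_coe e, Ideal.map_map,
      Ideal.map_map]
    rfl
  rw [← E.height_map, hE]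
  exact h.trans (by rw [RingEquiv.height_comap])

/-! ### Euler's identity and the cone structure of `Z_φ`. -/

theorem encard_range_le_card {ι α : Type*} [Fintype ι] (f : ι → α) :
    (Set.range f).encard ≤ Fintype.card ι := by
  rw [← Set.image_univ]
  exact (Set.encard_image_le _ _).trans (by simp)

theorem sum_X_mul_pderiv_pderiv {k σ : Type*} [Field k] [Fintype σ] {d : ℕ} {f : MvPolynomial σ k}
    (hf : f.IsHomogeneous d) (i : σ) :
    ∑ j, X j * pderiv j (pderiv i f) = C ((d : k) - 1) * pderiv i f := by
  -- For `d = 0` the truncated degree `d - 1` would give the wrong coefficient, but both sides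
  -- vanish.
  rcases d with _ | d
  · rw [totalDegree_eq_zero_iff_eq_C.mp ((totalDegree_zero_iff_isHomogeneous _).mpr hf)]
    simp
  · have h := (hf.pderiv (i := i)).sum_X_mul_pderiv
    rw [h]
    simp

/-- The truncated degree is harmless: for `d ≤ 1` the second derivatives vanish. -/
theorem differential_polarMap_isHomogeneous {k σ : Type*} [Field k] [Fintype σ] {d : ℕ}
    {f : MvPolynomial σ k} (hf : f.IsHomogeneous d) (i : σ) :
    (differential (polarMap f) i).IsHomogeneous (d - 1 - 1 + 1) :=
  IsHomogeneous.sum _ _ _ fun _ _ =>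
    (hf.pderiv.pderiv.rename_isHomogeneous).mul (isHomogeneous_X k _)

theorem ker_constantCoeff_isMaximal (k σ : Type*) [Field k] :
    (RingHom.ker (constantCoeff : MvPolynomial σ k →+* k)).IsMaximal :=
  RingHom.ker_isMaximal_of_surjective _ fun c => ⟨C c, constantCoeff_C σ c⟩

/-- Every prime ideal `p` of a polynomial ring contains a prime ideal that lies below the ideal of
the origin and contains all the homogeneous elements of `p`. -/
theorem exists_prime_le_ker_constantCoeff {k σ : Type*} [Field k] (p : Ideal (MvPolynomial σ k))
    (hp : p.IsPrime) :
    ∃ P : Ideal (MvPolynomial σ k), P.IsPrime ∧ P ≤ p ∧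
      P ≤ RingHom.ker (constantCoeff : MvPolynomial σ k →+* k) ∧
      ∀ q ∈ p, ∀ n, q.IsHomogeneous n → q ∈ P := by
  let _ := MvPolynomial.gradedAlgebra (σ := σ) (R := k)
  let P := p.homogeneousCore (homogeneousSubmodule σ k)
  have hP : P.toIdeal.IsPrime := hp.homogeneousCore
  refine ⟨P.toIdeal, hP, Ideal.toIdeal_homogeneousCore_le _ _, fun q hq => ?_, fun q hq n hn =>
    Ideal.mem_homogeneousCore_of_homogeneous_of_mem ⟨n, hn⟩ hq⟩
  -- A nonzero constant term would be a unit in the homogeneous core.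
  have h := homogeneousComponent_mem_of_mem P.isHomogeneous hq 0
  rw [homogeneousComponent_zero] at h
  rw [RingHom.mem_ker, constantCoeff_eq]
  by_contra h0
  exact hP.ne_top (Ideal.eq_top_of_isUnit_mem _ h ((isUnit_iff_ne_zero.mpr h0).map C))

/-! ### Restriction to the diagonal. -/

theorem exists_mem_criticalLocus_height_le {k σ : Type*} [Field k] [Fintype σ] {d : ℕ}
    {f : MvPolynomial σ k} (hd : (d : k) - 1 ≠ 0) (hf : f.IsHomogeneous d)
    (P : Ideal (MvPolynomial (σ ⊕ σ) k)) [P.IsPrime]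
    (hP0 : P ≤ RingHom.ker (constantCoeff : MvPolynomial (σ ⊕ σ) k →+* k))
    (hP : ∀ i, differential (polarMap f) i ∈ P) :
    ∃ Q ∈ criticalLocus f, Q.asIdeal.height ≤ P.height := by
  set M := RingHom.ker (constantCoeff : MvPolynomial (σ ⊕ σ) k →+* k)
  have hM : M.IsMaximal := ker_constantCoeff_isMaximal k (σ ⊕ σ)
  let s : Set (MvPolynomial (σ ⊕ σ) k ⧸ P) :=
    Set.range fun i : σ => Ideal.Quotient.mk P (X (Sum.inl i) - X (Sum.inr i))
  have hs : s ⊆ M.map (Ideal.Quotient.mk P) := by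
    rintro _ ⟨i, rfl⟩
    exact Ideal.mem_map_of_mem _ (by simp [M, RingHom.mem_ker])
  have hMP : (M.map (Ideal.Quotient.mk P)).IsPrime := Ideal.isPrime_map_quotientMk_of_isPrime hP0
  let π : MvPolynomial (σ ⊕ σ) k →+* (MvPolynomial (σ ⊕ σ) k ⧸ P) ⧸ Ideal.span s :=
    (Ideal.Quotient.mk _).comp (Ideal.Quotient.mk P)
  have hπ : ∀ i, π (X (Sum.inr i)) = π (X (Sum.inl i)) := fun i => by
    rw [eq_comm, ← sub_eq_zero, ← map_sub]
    exact Ideal.Quotient.eq_zero_iff_mem.mpr (Ideal.subset_span ⟨i, rfl⟩)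
  -- On the diagonal the base coordinates alone generate, so the slice embeds in `V`.
  let ψ : MvPolynomial σ k →+* (MvPolynomial (σ ⊕ σ) k ⧸ P) ⧸ Ideal.span s :=
    π.comp (rename Sum.inl).toRingHom
  have hψX : ∀ q, ψ q = π (rename Sum.inl q) := fun q => rfl
  have hψ : Function.Surjective ψ := by
    intro y
    obtain ⟨y, rfl⟩ := Ideal.Quotient.mk_surjective y
    obtain ⟨b, rfl⟩ := Ideal.Quotient.mk_surjective y
    change π b ∈ ψ.range
    induction b using MvPolynomial.induction_on with
    | C a => exact ⟨C a, by simp [hψX]⟩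
    | add p q hp hq => rw [map_add]; exact add_mem hp hq
    | mul_X p i hp =>
      rw [map_mul]
      refine mul_mem hp ?_
      rcases i with i | i
      · exact ⟨X i, by simp [hψX]⟩
      · exact ⟨X i, by simp [hψX, hπ]⟩
  have hker : ∀ i, pderiv i f ∈ RingHom.ker ψ := by
    intro i
    have h1 : C ((d : k) - 1) * pderiv i f ∈ RingHom.ker ψ := by
      rw [← sum_X_mul_pderiv_pderiv hf, RingHom.mem_ker, map_sum]
      have h2 : π (differential (polarMap f) i) = 0 := by
        rw [RingHom.comp_apply, Ideal.Quotient.eq_zero_iff_mem.mpr (hP i), map_zero]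
      rw [← h2, differential, map_sum]
      refine Finset.sum_congr rfl fun j _ => ?_
      rw [map_mul, map_mul, hπ, mul_comm (ψ _), hψX, hψX, rename_X, polarMap]
    have h3 := (RingHom.ker ψ).mul_mem_left (C ((d : k) - 1)⁻¹) h1
    rwa [← mul_assoc, ← C_mul, inv_mul_cancel₀ hd, C_1, one_mul] at h3
  have h1 := card_le_height_quotient_add_height P M hP0
  have h2 := Ideal.height_le_ringKrullDim_quotient_add_encard s hs
  have hscard : s.encard ≤ Fintype.card σ := encard_range_le_card _
  obtain ⟨h, hh⟩ := ENat.ne_top_iff_exists.mp (Ideal.height_ne_top_of_isPrime (I := P))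
  have h3 : ((Fintype.card σ + Fintype.card σ : ℕ) : WithBot ℕ∞) ≤
      ringKrullDim ((MvPolynomial (σ ⊕ σ) k ⧸ P) ⧸ Ideal.span s) + Fintype.card σ + h := by
    rw [Fintype.card_sum, ← hh] at h1
    calc _ ≤ (((M.map (Ideal.Quotient.mk P)).height : ℕ∞) : WithBot ℕ∞) + h := by
            exact_mod_cast h1
      _ ≤ ringKrullDim ((MvPolynomial (σ ⊕ σ) k ⧸ P) ⧸ Ideal.span s) + s.encard + h := by gcongr
      _ ≤ _ := by gcongr; exact_mod_cast hscard
  -- If `h` exceeds `n`, the truncated bound only says that the slice is nonempty, which `h3`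
  -- guarantees.
  have h4 : ((Fintype.card σ - h : ℕ) : WithBot ℕ∞) ≤
      ringKrullDim ((MvPolynomial (σ ⊕ σ) k ⧸ P) ⧸ Ideal.span s) := by
    generalize ringKrullDim ((MvPolynomial (σ ⊕ σ) k ⧸ P) ⧸ Ideal.span s) = D at h3
    induction D with
    | bot => simp at h3
    | coe D =>
      induction D with
      | top => exact le_top
      | coe D =>
        have h5 : Fintype.card σ + Fintype.card σ ≤ D + Fintype.card σ + h := by exact_mod_cast h3
        have h6 : Fintype.card σ - h ≤ D := by omega
        exact WithBot.coe_le_coe.mpr (Nat.cast_le.mpr h6)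
  have hdim : ringKrullDim (MvPolynomial σ k) = Fintype.card σ := by simp
  obtain ⟨Q, hQ, hQh⟩ := exists_prime_height_add_le
    (S := (MvPolynomial (σ ⊕ σ) k ⧸ P) ⧸ Ideal.span s) ψ hψ hdim.le h4
  refine ⟨Q, ?_, ?_⟩
  · rintro _ ⟨i, rfl⟩
    exact hQ (hker i)
  · rw [← hh]
    obtain ⟨q, hq⟩ := ENat.ne_top_iff_exists.mp (Ideal.height_ne_top_of_isPrime (I := Q.asIdeal))
    rw [← hq] at hQh ⊢
    have : q + (Fintype.card σ - h) ≤ Fintype.card σ := by exact_mod_cast hQh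
    have : q ≤ h := by omega
    exact_mod_cast this

theorem codim_criticalLocus_le_rkTB {k σ : Type*} [Field k] [Fintype σ] {d : ℕ}
    {f : MvPolynomial σ k} (hd : (d : k) - 1 ≠ 0) (hf : f.IsHomogeneous d) :
    codim (criticalLocus f) ≤ rkTB (polarMap f) := by
  refine le_iInf₂ fun p hp => ?_
  obtain ⟨P, hP, hPp, hP0, hPh⟩ := exists_prime_le_ker_constantCoeff p.asIdeal p.isPrime
  obtain ⟨Q, hQ, hQh⟩ := exists_mem_criticalLocus_height_le hd hf P hP0 fun i =>
    hPh _ (hp ⟨i, rfl⟩) _ (differential_polarMap_isHomogeneous hf i)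
  exact (iInf₂_le Q hQ).trans (hQh.trans (Ideal.height_mono hPp))

/-! ### Cases of equality and the singular locus. -/

/-- `Z_φ` contains the zero section `v = 0`, cut out by `n` equations; Krull's height theorem
applies. -/
theorem rkTB_le_card {k σ τ : Type*} [Field k] [Fintype σ] (φ : τ → MvPolynomial σ k) :
    rkTB φ ≤ Fintype.card σ := by
  let s : Set (MvPolynomial (σ ⊕ σ) k) := Set.range fun i => X (Sum.inr i)
  have hs0 : Ideal.span s ≤ RingHom.ker (constantCoeff : MvPolynomial (σ ⊕ σ) k →+* k) := by
    rw [Ideal.span_le]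
    rintro _ ⟨i, rfl⟩
    simp [RingHom.mem_ker]
  have := (ker_constantCoeff_isMaximal k (σ ⊕ σ)).isPrime
  obtain ⟨P, hP, -⟩ := Ideal.exists_minimalPrimes_le hs0
  have hPp : P.IsPrime := hP.1.1
  have hmem : (⟨P, hPp⟩ : PrimeSpectrum _) ∈ tangentKernel φ := by
    rintro _ ⟨j, rfl⟩
    exact sum_mem fun i _ => P.mul_mem_left _ (hP.1.2 (Ideal.subset_span ⟨i, rfl⟩))
  refine (iInf₂_le _ hmem).trans ?_
  refine (Ideal.height_le_card_of_mem_minimalPrimes_span (Set.finite_range _) hP).trans ?_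
  rw [(Set.finite_range _).cast_ncard_eq]
  exact encard_range_le_card _

/-- By the Nullstellensatz, every prime in the critical locus contains the maximal ideal of the
origin. -/
theorem card_le_codim_criticalLocus {k σ : Type*} [Field k] [Fintype σ] {f : MvPolynomial σ k}
    (h : ∀ a : σ → AlgebraicClosure k, a ≠ 0 → ∃ i, aeval a (pderiv i f) ≠ 0) :
    (Fintype.card σ : ℕ∞) ≤ codim (criticalLocus f) := by
  refine le_iInf₂ fun p hp => ?_
  have hM := ker_constantCoeff_isMaximal k σ
  rw [← height_of_isMaximal (RingHom.ker (constantCoeff : MvPolynomial σ k →+* k))]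
  refine Ideal.height_mono ?_
  rw [← IsPrime.vanishingIdeal_zeroLocus (K := AlgebraicClosure k) p.asIdeal]
  intro q hq a ha
  obtain rfl : a = 0 := by
    by_contra ha0
    obtain ⟨i, hi⟩ := h a ha0
    exact hi (ha _ (hp ⟨i, rfl⟩))
  rw [RingHom.mem_ker] at hq
  simp [hq]

theorem criticalLocus_subset_zeroLocus {k σ : Type*} [Field k] [Fintype σ] {d : ℕ}
    {f : MvPolynomial σ k} (hd : (d : k) ≠ 0) (hf : f.IsHomogeneous d) :
    criticalLocus f ⊆ PrimeSpectrum.zeroLocus {f} := by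
  intro p hp
  rw [PrimeSpectrum.mem_zeroLocus, Set.singleton_subset_iff]
  have h1 : C (d : k) * f ∈ p.asIdeal := by
    have := hf.sum_X_mul_pderiv
    rw [nsmul_eq_mul, ← map_natCast (C : k →+* MvPolynomial σ k)] at this
    rw [← this]
    exact sum_mem fun i _ => p.asIdeal.mul_mem_left _ (hp ⟨i, rfl⟩)
  have h2 := p.asIdeal.mul_mem_left (C (d : k)⁻¹) h1
  rwa [← mul_assoc, ← C_mul, inv_mul_cancel₀ hd, C_1, one_mul] at h2

theorem exists_pderiv_ne_zero_of_smooth {k σ : Type*} [Field k] [Fintype σ] {d : ℕ}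
    {f : MvPolynomial σ k} (hd : (d : k) ≠ 0) (hf : f.IsHomogeneous d)
    (hs : SmoothProjectiveHypersurface f) (a : σ → AlgebraicClosure k) (ha : a ≠ 0) :
    ∃ i, aeval a (pderiv i f) ≠ 0 := by
  by_contra! h
  have h1 : aeval a (d • f) = 0 := by
    rw [← hf.sum_X_mul_pderiv, map_sum]
    exact Finset.sum_eq_zero fun i _ => by rw [map_mul, h, mul_zero]
  rw [map_nsmul, nsmul_eq_mul, ← map_natCast (algebraMap k (AlgebraicClosure k))] at h1
  have h2 := (mul_eq_zero.mp h1).resolve_left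
    ((map_ne_zero_iff _ (algebraMap k (AlgebraicClosure k)).injective).mpr hd)
  obtain ⟨i, hi⟩ := hs a ha h2
  exact hi (h i)

end PolarRank

theorem corollary3p6 {k : Type*} [Field k] {σ : Type*} [Fintype σ] (d : ℕ)
    (f : MvPolynomial σ k) (hf : f.IsHomogeneous d)
    (hd : ¬ (ringChar k : ℤ) ∣ (d : ℤ) - 1) :
    PolarRank.codim (PolarRank.criticalLocus f) ≤ PolarRank.rkTB (PolarRank.polarMap f) ∧
    ((∀ a : σ → AlgebraicClosure k, a ≠ 0 →
        ∃ i, MvPolynomial.aeval a (MvPolynomial.pderiv i f) ≠ 0) →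
      PolarRank.rkTB (PolarRank.polarMap f) = (Fintype.card σ : ℕ∞)) ∧
    (¬ ringChar k ∣ d →
      PolarRank.c f ≤ PolarRank.rkTB (PolarRank.polarMap f) ∧
      (PolarRank.SmoothProjectiveHypersurface f →
        PolarRank.rkTB (PolarRank.polarMap f) = (Fintype.card σ : ℕ∞))) := by
  have hd' : (d : k) - 1 ≠ 0 := by
    have h := (CharP.intCast_eq_zero_iff k (ringChar k) ((d : ℤ) - 1)).not.mpr hd
    simpa using h
  have h1 := PolarRank.codim_criticalLocus_le_rkTB hd' hf
  have h2 : (∀ a : σ → AlgebraicClosure k, a ≠ 0 →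
      ∃ i, MvPolynomial.aeval a (MvPolynomial.pderiv i f) ≠ 0) →
      PolarRank.rkTB (PolarRank.polarMap f) = (Fintype.card σ : ℕ∞) := fun h =>
    (PolarRank.rkTB_le_card _).antisymm ((PolarRank.card_le_codim_criticalLocus h).trans h1)
  refine ⟨h1, h2, fun hdk => ?_⟩
  have hdk' : (d : k) ≠ 0 := (CharP.cast_eq_zero_iff k (ringChar k) d).not.mpr hdk
  refine ⟨?_, fun hs => h2 (PolarRank.exists_pderiv_ne_zero_of_smooth hdk' hf hs)⟩
  rwa [PolarRank.c, PolarRank.singularLocus,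
    Set.inter_eq_right.mpr (PolarRank.criticalLocus_subset_zeroLocus hdk' hf)]
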